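/- Let $m,n$ be non-negative integers, let $A$ be a real $m\times n$ matrix that has at least $n-1$ linearly independent rows, let $C=AA^T$, and let $X_C=\{B\in\mathbb{R}^{m\times n} : BB^T=C\}$ be the set of all solutions of the system $BB^T=C$. For a set $S$ of entry positions $(i,j)$ and $B\in X_C$, call the matrices $B'\in X_C$ with $B'_{ij}=B_{ij}$ for all $(i,j)\in S$ the completions of $B|_S$. A property holds for a generic solution if it holds for all $B$ in some relatively open dense subset of $X_C$. The degrees of freedom of the system $BB^T=C$ is the number of entries that must be known in order to determine the matrix up to finitely many possibilities, that is, the least cardinality of a set $S$ of positions such that, for a generic solution $B\in X_C$, there are only finitely many completions of $B|_S$. Then the degrees of freedom of $BB^T=C$ is exactly $\frac{n(n-1)}{2}$. Moreover, for every set $S$ of fewer than $\frac{n(n-1)}{2}$ positions, a generic solution $B\in X_C$ has infinitely many completions of $B|_S$. -/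

import Mathlib

open scoped Matrix

/-- The set of all real `m × n` matrices `B` with `B * Bᵀ = C`. -/
def solutionSet {m : ℕ} (n : ℕ) (C : Matrix (Fin m) (Fin m) ℝ) :
    Set (Matrix (Fin m) (Fin n) ℝ) :=
  {B | B * Bᵀ = C}

/-- The solutions that remain possible once the entries of the solution `B` at the positions in `S`
are known: all solutions that agree with `B` on `S`. -/
def completions {m n : ℕ} (C : Matrix (Fin m) (Fin m) ℝ) (S : Finset (Fin m × Fin n))
    (B : Matrix (Fin m) (Fin n) ℝ) : Set (Matrix (Fin m) (Fin n) ℝ) :=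
  {B' | B' ∈ solutionSet n C ∧ ∀ p ∈ S, B' p.1 p.2 = B p.1 p.2}

/-- The property `P` holds for a generic solution: it holds on a relatively open and dense subset
of the solution set. -/
def ForGenericSolution {m n : ℕ} (C : Matrix (Fin m) (Fin m) ℝ)
    (P : Matrix (Fin m) (Fin n) ℝ → Prop) : Prop :=
  ∃ U : Set (Matrix (Fin m) (Fin n) ℝ), IsOpen U ∧
    solutionSet n C ⊆ closure (solutionSet n C ∩ U) ∧
    ∀ B ∈ solutionSet n C ∩ U, P B

/-- The degrees of freedom of the system `B * Bᵀ = C` in the entries of an `m × n` matrix `B`: the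
least number of entries, at suitable positions, that have to be known so that a generic solution is
determined up to finitely many possibilities. (Knowing all entries always suffices, so the infimum
is a minimum.) -/
noncomputable def degreesOfFreedom {m : ℕ} (n : ℕ) (C : Matrix (Fin m) (Fin m) ℝ) : ℕ :=
  sInf {k : ℕ | ∃ S : Finset (Fin m × Fin n), S.card = k ∧
    ForGenericSolution C fun B => (completions C S B).Finite}

/-! Lower bound: for skew-symmetric `K` the direction `B * K` is tangent to the solution set at `B`,
and `K ↦ B * K` is injective since the rows of `B` span at least a hyperplane. Fewer than `n * (n -
1) / 2` known entries impose too few linear conditions on `K`, so a nonzero direction keeps them all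
stationary. Where the rank of these conditions is locally constant, such directions extend to a C¹
vector field, and its integral curve through `B` consists of completions (`infinite_completions`).

Upper bound: reveal the first `n - 1 - i` entries of the `i`-th of `n - 1` independent rows,
counting from 0. Given the `i` earlier rows, `C` prescribes the inner products with them, so
together with the known entries there are `n - 1` linear conditions on the row. If they are
independent, the row lies on a line, and its prescribed norm leaves at most two choices
(`finite_image_row`). Once these rows are fixed, the same argument bounds every other row.

Independence must hold for all completions of the earlier rows, not only for `B`. Compactness makes
its failure closed (`isClosed_exists_degenerate_completion`). It is achieved near any solution by
rotations that fix the earlier rows and move the next row off finitely many hyperplanes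
(`exists_nondegenerate_perturbation`). -/

/-! ### Skew-symmetric matrices and tangent directions. -/

/-- By skewness, `K *ᵥ x` is orthogonal to every `b i` and to `x` itself. If `x` is outside the span
of `b`, these vectors span the whole space. -/
theorem eq_zero_of_transpose_eq_neg_of_mulVec_eq_zero {n k : ℕ} {b : Fin k → Fin n → ℝ}
    (hb : LinearIndependent ℝ b) (hk : n ≤ k + 1) {K : Matrix (Fin n) (Fin n) ℝ}
    (hK : Kᵀ = -K) (h : ∀ i, K *ᵥ b i = 0) : K = 0 := by
  have hskew : ∀ x y, K *ᵥ x ⬝ᵥ y = -(x ⬝ᵥ K *ᵥ y) := fun x y => by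
    rw [Matrix.dotProduct_mulVec, ← Matrix.mulVec_transpose, hK, Matrix.neg_mulVec,
      neg_dotProduct, neg_neg]
  have hker : ∀ x, K *ᵥ x = 0 := by
    intro x
    let f : (Fin n → ℝ) →ₗ[ℝ] ℝ :=
      { toFun := fun y => K *ᵥ x ⬝ᵥ y
        map_add' := fun y z => dotProduct_add _ _ _
        map_smul' := fun c y => by simp }
    have hbf : ∀ i, b i ∈ LinearMap.ker f := fun i => by
      change K *ᵥ x ⬝ᵥ b i = 0
      rw [hskew, h, dotProduct_zero, neg_zero]
    have hxf : x ∈ LinearMap.ker f := by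
      change K *ᵥ x ⬝ᵥ x = 0
      have h1 := hskew x x
      rw [dotProduct_comm x] at h1
      linarith
    have hle : Submodule.span ℝ (Set.range b) ≤ LinearMap.ker f :=
      Submodule.span_le.2 (by rintro _ ⟨i, rfl⟩; exact hbf i)
    by_cases hx : x ∈ Submodule.span ℝ (Set.range b)
    · refine Submodule.span_induction (p := fun y _ => K *ᵥ y = 0) ?_ ?_ ?_ ?_ hx
      · rintro _ ⟨i, rfl⟩; exact h i
      · exact Matrix.mulVec_zero K
      · intro y z _ _ hy hz; rw [Matrix.mulVec_add, hy, hz, add_zero]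
      · intro c y _ hy; rw [Matrix.mulVec_smul, hy, smul_zero]
    · have hlt : Submodule.span ℝ (Set.range b) < LinearMap.ker f :=
        lt_of_le_of_ne hle fun heq => hx (heq ▸ hxf)
      have h1 := Submodule.finrank_lt_finrank_of_lt hlt
      rw [finrank_span_eq_card hb, Fintype.card_fin] at h1
      have htop : LinearMap.ker f = ⊤ := by
        apply Submodule.eq_top_of_finrank_eq
        refine le_antisymm (Submodule.finrank_le _) ?_
        rw [Module.finrank_fin_fun]
        omega
      have : f (K *ᵥ x) = 0 := by
        rw [← LinearMap.mem_ker, htop]; trivial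
      exact dotProduct_self_eq_zero.1 this
  ext i j
  simpa using congrFun (hker (Pi.single j 1)) i

theorem vecMul_dotProduct_self {m n : ℕ} (B : Matrix (Fin m) (Fin n) ℝ) (w : Fin m → ℝ) :
    (w ᵥ* B) ⬝ᵥ (w ᵥ* B) = w ⬝ᵥ (B * Bᵀ) *ᵥ w := by
  rw [← Matrix.mulVec_mulVec, Matrix.mulVec_transpose, Matrix.dotProduct_mulVec]

/-- The Gram matrix determines the norm of each combination of rows, hence all linear relations
among them. -/
theorem linearIndependent_rows_of_mul_transpose_eq {m n k : ℕ} {A B : Matrix (Fin m) (Fin n) ℝ}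
    (h : B * Bᵀ = A * Aᵀ) {r : Fin k → Fin m} (hA : LinearIndependent ℝ fun i => A (r i)) :
    LinearIndependent ℝ fun i => B (r i) := by
  rw [Fintype.linearIndependent_iff] at hA ⊢
  intro g hg
  refine hA g ?_
  have hw : ∀ D : Matrix (Fin m) (Fin n) ℝ,
      (∑ i, g i • (Pi.single (r i) 1 : Fin m → ℝ)) ᵥ* D = ∑ i, g i • D (r i) := by
    intro D
    rw [Matrix.sum_vecMul]
    refine Finset.sum_congr rfl fun i _ => ?_
    rw [Matrix.smul_vecMul, Matrix.single_one_vecMul]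
    rfl
  rw [← hw] at hg ⊢
  apply dotProduct_self_eq_zero.1
  rw [vecMul_dotProduct_self, ← h, ← vecMul_dotProduct_self, hg, dotProduct_zero]

/-- The skew-symmetric matrix with prescribed entries above the diagonal. -/
def skewOfUpper {n : ℕ} :
    ({p : Fin n × Fin n // p.1 < p.2} → ℝ) →ₗ[ℝ] Matrix (Fin n) (Fin n) ℝ where
  toFun v := Matrix.of fun i j =>
    if h : i < j then v ⟨(i, j), h⟩ else if h : j < i then -v ⟨(j, i), h⟩ else 0
  map_add' v w := by
    ext i j
    simp only [Pi.add_apply, Matrix.add_apply, Matrix.of_apply]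
    split_ifs <;> ring
  map_smul' c v := by
    ext i j
    simp only [Pi.smul_apply, Matrix.smul_apply, Matrix.of_apply, RingHom.id_apply, smul_eq_mul]
    split_ifs <;> ring

theorem skewOfUpper_apply_of_lt {n : ℕ} (v : {p : Fin n × Fin n // p.1 < p.2} → ℝ)
    (p : {p : Fin n × Fin n // p.1 < p.2}) : skewOfUpper v p.1.1 p.1.2 = v p :=
  dif_pos p.2

theorem skewOfUpper_transpose {n : ℕ} (v : {p : Fin n × Fin n // p.1 < p.2} → ℝ) :
    (skewOfUpper v)ᵀ = -skewOfUpper v := by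
  ext i j
  change (if h : j < i then v ⟨(j, i), h⟩ else if h : i < j then -v ⟨(i, j), h⟩ else 0) =
    -(if h : i < j then v ⟨(i, j), h⟩ else if h : j < i then -v ⟨(j, i), h⟩ else 0)
  split_ifs with h1 h2 <;> first | simp | (exfalso; omega)

theorem eq_zero_of_skewOfUpper_eq_zero {n : ℕ} {v : {p : Fin n × Fin n // p.1 < p.2} → ℝ}
    (h : skewOfUpper v = 0) : v = 0 := by
  ext p
  rw [← skewOfUpper_apply_of_lt v, h]
  rfl

theorem card_lt_pairs (n : ℕ) :
    Fintype.card {p : Fin n × Fin n // p.1 < p.2} = n * (n - 1) / 2 := by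
  rw [Fintype.card_subtype, ← Finset.univ_product_univ, Finset.card_filter, Finset.sum_product]
  simp only [← Finset.card_filter]
  have : ∀ i : Fin n, (Finset.univ.filter fun j : Fin n => i < j).card = n - 1 - i := by
    intro i
    rw [← Fin.card_Ioi]
    congr 1
    ext j
    simp
  simp only [this]
  rw [Fin.sum_univ_eq_sum_range (fun i => n - 1 - i) n, Finset.sum_range_reflect (fun i => i) n,
    Finset.sum_range_id]

/-- The entry at position `p` of `B * K`, for `K` skew-symmetric, as a linear form in the entries of
`K` above the diagonal. -/
noncomputable def tangentForm {m n : ℕ} (B : Fin m → Fin n → ℝ) (p : Fin m × Fin n) :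
    {p : Fin n × Fin n // p.1 < p.2} → ℝ :=
  fun a => ∑ k, B p.1 k * skewOfUpper (fun b => if a = b then 1 else 0) k p.2

theorem tangentForm_dotProduct {m n : ℕ} (B : Matrix (Fin m) (Fin n) ℝ) (p : Fin m × Fin n)
    (v : {p : Fin n × Fin n // p.1 < p.2} → ℝ) :
    tangentForm B p ⬝ᵥ v = (B * skewOfUpper v) p.1 p.2 := by
  let f : ({p : Fin n × Fin n // p.1 < p.2} → ℝ) →ₗ[ℝ] ℝ :=
    { toFun := fun v => (B * skewOfUpper v) p.1 p.2
      map_add' := fun x y => by simp [Matrix.mul_add]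
      map_smul' := fun c x => by simp }
  change _ = f v
  rw [LinearMap.pi_apply_eq_sum_univ f v]
  refine Finset.sum_congr rfl fun a _ => ?_
  rw [smul_eq_mul, mul_comm]
  rfl

theorem contDiff_tangentForm {m n : ℕ} (p : Fin m × Fin n)
    (a : {p : Fin n × Fin n // p.1 < p.2}) :
    ContDiff ℝ 1 fun B : Fin m → Fin n → ℝ => tangentForm B p a := by
  unfold tangentForm
  fun_prop

theorem isOpen_linearIndepOn_tangentForm {m n : ℕ} (S : Set (Fin m × Fin n)) :
    IsOpen {B : Fin m → Fin n → ℝ | LinearIndepOn ℝ (tangentForm B) S} := by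
  have hc : Continuous fun (B : Fin m → Fin n → ℝ) (p : S) => tangentForm B p :=
    continuous_pi fun p => continuous_pi fun a => (contDiff_tangentForm p.1 a).continuous
  exact isOpen_setOfPred_linearIndependent.preimage hc

/-! ### Kernel vectors depending smoothly on the matrix. -/

theorem contDiff_det {E ι : Type*} [NormedAddCommGroup E] [NormedSpace ℝ E] [Fintype ι]
    [DecidableEq ι] {M : E → Matrix ι ι ℝ} (hM : ∀ i j, ContDiff ℝ 1 fun x => M x i j) :
    ContDiff ℝ 1 fun x => (M x).det := by
  simp only [Matrix.det_apply]
  exact ContDiff.sum fun σ _ => (contDiff_prod fun i _ => hM _ _).const_smul _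

theorem contDiff_adjugate {E ι : Type*} [NormedAddCommGroup E] [NormedSpace ℝ E] [Fintype ι]
    [DecidableEq ι] {M : E → Matrix ι ι ℝ} (hM : ∀ i j, ContDiff ℝ 1 fun x => M x i j) (i j : ι) :
    ContDiff ℝ 1 fun x => (M x).adjugate i j := by
  simp only [Matrix.adjugate_apply]
  refine contDiff_det fun k l => ?_
  simp only [Matrix.updateRow_apply]
  split_ifs
  · exact contDiff_const
  · exact hM _ _

theorem det_mul_transpose_ne_zero {ι κ : Type*} [Fintype ι] [DecidableEq ι] [Fintype κ]
    {M : Matrix ι κ ℝ} (h : LinearIndependent ℝ M) : (M * Mᵀ).det ≠ 0 := by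
  intro h0
  obtain ⟨v, hv, hv0⟩ := Matrix.exists_mulVec_eq_zero_iff.2 h0
  apply hv
  rw [← Matrix.conjTranspose_eq_transpose_of_trivial, Matrix.self_mul_conjTranspose_mulVec_eq_zero,
    Matrix.conjTranspose_eq_transpose_of_trivial, Matrix.mulVec_transpose] at hv0
  ext i
  refine Fintype.linearIndependent_iff.1 h v ?_ i
  rw [← hv0, Matrix.vecMul_eq_sum]

/-- The projection of `v` to the kernel of `M`, multiplied by `det (M * Mᵀ)`. -/
noncomputable def kernelProjection {ι κ : Type*} [Fintype ι] [DecidableEq ι] [Fintype κ]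
    (M : Matrix ι κ ℝ) (v : κ → ℝ) : κ → ℝ :=
  (M * Mᵀ).det • v - Mᵀ *ᵥ ((M * Mᵀ).adjugate *ᵥ (M *ᵥ v))

theorem mulVec_kernelProjection {ι κ : Type*} [Fintype ι] [DecidableEq ι] [Fintype κ]
    (M : Matrix ι κ ℝ) (v : κ → ℝ) : M *ᵥ kernelProjection M v = 0 := by
  rw [kernelProjection, Matrix.mulVec_sub, Matrix.mulVec_smul, Matrix.mulVec_mulVec,
    Matrix.mulVec_mulVec, Matrix.mul_adjugate, Matrix.smul_mulVec, Matrix.one_mulVec, sub_self]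

/-- Using the adjugate in place of the inverse makes the projection polynomial in the entries of
`M`, so it is smooth even where the rank drops. -/
theorem contDiff_kernelProjection {E ι κ : Type*} [NormedAddCommGroup E] [NormedSpace ℝ E]
    [Fintype ι] [DecidableEq ι] [Fintype κ] {M : E → Matrix ι κ ℝ}
    (hM : ∀ i j, ContDiff ℝ 1 fun x => M x i j) (v : κ → ℝ) (a : κ) :
    ContDiff ℝ 1 fun x => kernelProjection (M x) v a := by
  have hG : ∀ i j, ContDiff ℝ 1 fun x => (M x * (M x)ᵀ) i j := fun i j => by
    simp only [Matrix.mul_apply, Matrix.transpose_apply]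
    exact ContDiff.sum fun k _ => (hM _ _).mul (hM _ _)
  simp only [kernelProjection, Pi.sub_apply, Pi.smul_apply, smul_eq_mul, Matrix.mulVec,
    dotProduct, Matrix.transpose_apply]
  refine ((contDiff_det hG).mul contDiff_const).sub (ContDiff.sum fun k _ => (hM _ _).mul
    (ContDiff.sum fun l _ => (contDiff_adjugate hG _ _).mul
      (ContDiff.sum fun b _ => (hM _ _).mul contDiff_const)))

/-- The tangent vector `B * K` at `B`, where `K` is skew-symmetric with entries `v` above the
diagonal. -/
def tangentVector {m n : ℕ} (B : Fin m → Fin n → ℝ) (v : {p : Fin n × Fin n // p.1 < p.2} → ℝ) :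
    Fin m → Fin n → ℝ :=
  Matrix.of B * skewOfUpper v

theorem contDiff_tangentVector {m n : ℕ}
    {v : (Fin m → Fin n → ℝ) → {p : Fin n × Fin n // p.1 < p.2} → ℝ}
    (hv : ∀ a, ContDiff ℝ 1 fun B => v B a) :
    ContDiff ℝ 1 fun B : Fin m → Fin n → ℝ => tangentVector B (v B) := by
  refine contDiff_pi.2 fun i => contDiff_pi.2 fun j => ?_
  change ContDiff ℝ 1 fun B : Fin m → Fin n → ℝ => (Matrix.of B * skewOfUpper (v B)) i j
  have : ∀ B : Fin m → Fin n → ℝ, (Matrix.of B * skewOfUpper (v B)) i j =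
      tangentForm B (i, j) ⬝ᵥ v B := fun B => (tangentForm_dotProduct B (i, j) (v B)).symm
  simp only [this, dotProduct]
  exact ContDiff.sum fun a _ => (contDiff_tangentForm _ a).mul (hv a)

/-! ### Too few positions: curves of completions. -/

theorem mem_solutionSet_of_tangent {m n : ℕ} {C : Matrix (Fin m) (Fin m) ℝ} {s : Set ℝ}
    (hs : IsOpen s) (hs' : IsPreconnected s) {α : ℝ → Fin m → Fin n → ℝ}
    {v : ℝ → {p : Fin n × Fin n // p.1 < p.2} → ℝ}
    (hα : ∀ t ∈ s, HasDerivAt α (tangentVector (α t) (v t)) t)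
    {t₀ : ℝ} (ht₀ : t₀ ∈ s) (h₀ : Matrix.of (α t₀) ∈ solutionSet n C) {t : ℝ} (ht : t ∈ s) :
    Matrix.of (α t) ∈ solutionSet n C := by
  rw [← show Matrix.of (α t₀) * (Matrix.of (α t₀))ᵀ = C from h₀]
  change Matrix.of (α t) * (Matrix.of (α t))ᵀ = _
  ext i k
  have hd : ∀ u ∈ s, HasDerivAt (fun u => (Matrix.of (α u) * (Matrix.of (α u))ᵀ) i k) 0 u := by
    intro u hu
    have h1 : ∀ i j, HasDerivAt (fun u => α u i j)
        ((Matrix.of (α u) * skewOfUpper (v u)) i j) u := fun i j =>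
      hasDerivAt_pi.1 (hasDerivAt_pi.1 (hα u hu) i) j
    have h2 := HasDerivAt.fun_sum (u := Finset.univ) fun j _ => (h1 i j).mul (h1 k j)
    have h3 : (Matrix.of (α u) * skewOfUpper (v u)) * (Matrix.of (α u))ᵀ +
        Matrix.of (α u) * (Matrix.of (α u) * skewOfUpper (v u))ᵀ = 0 := by
      rw [Matrix.transpose_mul, skewOfUpper_transpose, Matrix.neg_mul, Matrix.mul_neg,
        Matrix.mul_assoc, add_neg_cancel]
    have h4 := congrFun (congrFun h3 i) k
    rw [Finset.sum_add_distrib] at h2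
    exact h2.congr_deriv h4
  exact hs.is_const_of_deriv_eq_zero hs'
    (fun u hu => (hd u hu).differentiableAt.differentiableWithinAt)
    (fun u hu => (hd u hu).deriv) ht ht₀

open Topology Filter in
-- Follow the vector field given by projecting a fixed `v₀` to the common kernel of the forms in
-- `T`. The span hypothesis then makes the entries in `S` stationary as well.
theorem infinite_completions {m n k : ℕ} {C : Matrix (Fin m) (Fin m) ℝ}
    {B : Matrix (Fin m) (Fin n) ℝ} (hB : B ∈ solutionSet n C) {r : Fin k → Fin m}
    (hr : LinearIndependent ℝ fun i => B (r i)) (hk : n ≤ k + 1) {S T : Finset (Fin m × Fin n)}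
    (hT : LinearIndepOn ℝ (tangentForm B) T) (hcard : T.card < n * (n - 1) / 2)
    (hS : ∀ᶠ B' : Fin m → Fin n → ℝ in 𝓝 B, Matrix.of B' ∈ solutionSet n C →
      ∀ q ∈ S, tangentForm B' q ∈ Submodule.span ℝ (tangentForm B' '' T)) :
    (completions C S B).Infinite := by
  let M : (Fin m → Fin n → ℝ) → Matrix T {p : Fin n × Fin n // p.1 < p.2} ℝ :=
    fun B' => Matrix.of fun p => tangentForm B' p
  obtain ⟨v₀, hv₀, hv₀0⟩ : ∃ v₀ ∈ LinearMap.ker (M B).mulVecLin, v₀ ≠ 0 := by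
    refine Submodule.exists_mem_ne_zero_of_ne_bot (LinearMap.ker_ne_bot_of_finrank_lt ?_)
    simpa [card_lt_pairs] using hcard
  replace hv₀ : M B *ᵥ v₀ = 0 := hv₀
  let v := fun B' => kernelProjection (M B') v₀
  have hvB : v B ≠ 0 := by
    simp only [v, kernelProjection, hv₀, Matrix.mulVec_zero, sub_zero]
    exact smul_ne_zero (det_mul_transpose_ne_zero hT) hv₀0
  let X : (Fin m → Fin n → ℝ) → Fin m → Fin n → ℝ :=
    fun B' => tangentVector B' (v B')
  have hX : ContDiff ℝ 1 X := contDiff_tangentVector fun a =>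
    contDiff_kernelProjection (M := M) (fun i j => contDiff_tangentForm _ _) _ _
  have hXB : X B ≠ 0 := by
    intro h0
    apply hvB
    apply eq_zero_of_skewOfUpper_eq_zero
    refine eq_zero_of_transpose_eq_neg_of_mulVec_eq_zero hr hk (skewOfUpper_transpose _) fun i => ?_
    have h1 : B * skewOfUpper (v B) = 0 := h0
    have h2 : skewOfUpper (v B) * Bᵀ = 0 := by
      have := congrArg Matrix.transpose h1
      rwa [Matrix.transpose_mul, skewOfUpper_transpose, Matrix.transpose_zero, Matrix.neg_mul,
        neg_eq_zero] at this
    ext j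
    exact congrFun (congrFun h2 j) (r i)
  have hXat : ContDiffAt ℝ 1 X B := hX.contDiffAt
  obtain ⟨ρ, hρ, ε, hε, hα⟩ :=
    hXat.exists_forall_mem_closedBall_exists_eq_forall_mem_Ioo_hasDerivAt 0
  obtain ⟨α, hα0, hα⟩ := hα B (Metric.mem_closedBall_self hρ.le)
  rw [zero_sub, zero_add] at hα
  have h0 : (0 : ℝ) ∈ Set.Ioo (-ε) ε := ⟨neg_lt_zero.2 hε, hε⟩
  have hcont : Tendsto α (𝓝 0) (𝓝 B) := by
    have := (hα 0 h0).continuousAt.tendsto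
    rwa [hα0] at this
  obtain ⟨δ, hδ, hδS⟩ := Metric.eventually_nhds_iff.1 (hcont.eventually hS)
  set η := min ε δ
  have hη : 0 < η := lt_min hε hδ
  have hηε : ∀ t ∈ Set.Ioo (-η) η, t ∈ Set.Ioo (-ε) ε := fun t ht =>
    ⟨by linarith [ht.1, min_le_left ε δ], ht.2.trans_le (min_le_left _ _)⟩
  have h0η : (0 : ℝ) ∈ Set.Ioo (-η) η := ⟨neg_lt_zero.2 hη, hη⟩
  have hsol : ∀ t ∈ Set.Ioo (-ε) ε, Matrix.of (α t) ∈ solutionSet n C := fun t ht =>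
    mem_solutionSet_of_tangent isOpen_Ioo isPreconnected_Ioo (v := fun t => v (α t)) hα h0
      (by rw [hα0]; exact hB) ht
  have hmem : ∀ t ∈ Set.Ioo (-η) η, Matrix.of (α t) ∈ completions C S B := by
    intro t ht
    refine ⟨hsol t (hηε t ht), fun p hp => ?_⟩
    have hd : ∀ u ∈ Set.Ioo (-η) η, HasDerivAt (fun u => α u p.1 p.2) 0 u := by
      intro u hu
      have h1 := hasDerivAt_pi.1 (hasDerivAt_pi.1 (hα u (hηε u hu)) p.1) p.2
      refine h1.congr_deriv ?_
      have hspan := hδS (y := u) (by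
        rw [Real.dist_eq, sub_zero]
        exact (abs_lt.2 ⟨hu.1, hu.2⟩).trans_le (min_le_right _ _)) (hsol u (hηε u hu)) p hp
      change (Matrix.of (α u) * skewOfUpper (v (α u))) p.1 p.2 = 0
      rw [← tangentForm_dotProduct]
      refine Submodule.span_induction (p := fun y _ => y ⬝ᵥ v (α u) = 0) ?_ ?_ ?_ ?_ hspan
      · rintro _ ⟨q, hq, rfl⟩
        exact congrFun (mulVec_kernelProjection (M (α u)) v₀) ⟨q, hq⟩
      · exact zero_dotProduct _
      · intro y z _ _ hy hz; rw [add_dotProduct, hy, hz, add_zero]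
      · intro c y _ hy; rw [smul_dotProduct, hy, smul_zero]
    have := isOpen_Ioo.is_const_of_deriv_eq_zero isPreconnected_Ioo
      (fun u hu => (hd u hu).differentiableAt.differentiableWithinAt)
      (fun u hu => (hd u hu).deriv) ht h0η
    simpa [hα0] using this
  intro hfin
  -- The nonzero velocity makes the curve leave `B`, yet its points tend to `B`, which a finite set
  -- without `B` cannot allow.
  have hclosed : IsClosed (completions C S B \ {B}) := (hfin.subset Set.sdiff_subset).isClosed
  have hne : ∀ᶠ t in 𝓝[≠] (0 : ℝ), α t ≠ B :=
    (hα 0 h0).eventually_ne (by rw [hα0]; exact hXB)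
  have hev : ∀ᶠ t in 𝓝[≠] (0 : ℝ), Matrix.of (α t) ∈ completions C S B \ {B} := by
    filter_upwards [hne, mem_nhdsWithin_of_mem_nhds (isOpen_Ioo.mem_nhds h0η)] with t h1 h2
    exact ⟨hmem t h2, h1⟩
  exact (hclosed.mem_of_tendsto (hcont.mono_left nhdsWithin_le_nhds) hev).2 rfl

theorem forGenericSolution_of_forall_open {m n : ℕ} {C : Matrix (Fin m) (Fin m) ℝ}
    {P : Matrix (Fin m) (Fin n) ℝ → Prop}
    (h : ∀ W : Set (Matrix (Fin m) (Fin n) ℝ), IsOpen W → (solutionSet n C ∩ W).Nonempty →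
      ∃ O : Set (Matrix (Fin m) (Fin n) ℝ), IsOpen O ∧ (solutionSet n C ∩ O ∩ W).Nonempty ∧
        ∀ B ∈ solutionSet n C ∩ O, P B) :
    ForGenericSolution C P := by
  refine ⟨⋃₀ {O | IsOpen O ∧ ∀ B ∈ solutionSet n C ∩ O, P B},
    isOpen_sUnion fun O hO => hO.1, ?_, ?_⟩
  · intro B hB
    rw [mem_closure_iff]
    intro W hW hBW
    obtain ⟨O, hO, ⟨B', ⟨hB', hBO⟩, hBW'⟩, hP⟩ := h W hW ⟨B, hB, hBW⟩
    exact ⟨B', hBW', hB', O, ⟨hO, hP⟩, hBO⟩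
  · rintro B ⟨hB, O, hO, hBO⟩
    exact hO.2 B ⟨hB, hBO⟩

/-- Choose `T ⊆ S` of maximal size among sets independent at some solution in `W`. Independence of
`T` is open, and wherever it holds in `W`, maximality puts all other forms of `S` in the span. -/
theorem forGenericSolution_infinite_completions {m n k : ℕ} {A : Matrix (Fin m) (Fin n) ℝ}
    {r : Fin k → Fin m} (hr : LinearIndependent ℝ fun i => A (r i)) (hk : n ≤ k + 1)
    {S : Finset (Fin m × Fin n)} (hS : S.card < n * (n - 1) / 2) :
    ForGenericSolution (A * Aᵀ) fun B => (completions (A * Aᵀ) S B).Infinite := by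
  classical
  refine forGenericSolution_of_forall_open fun W hW hWne => ?_
  obtain ⟨T, hT, hTmax⟩ := Finset.exists_max_image
    (S.powerset.filter fun T : Finset (Fin m × Fin n) => ∃ B ∈ solutionSet n (A * Aᵀ) ∩ W,
      LinearIndepOn ℝ (tangentForm B) (T : Set (Fin m × Fin n))) Finset.card
    ⟨∅, by
      obtain ⟨B, hB⟩ := hWne
      simpa using ⟨B, hB⟩⟩
  simp only [Finset.mem_filter, Finset.mem_powerset] at hT hTmax
  obtain ⟨hTS, B, hB, hTB⟩ := hT
  have hopen : IsOpen (W ∩ {B' : Matrix (Fin m) (Fin n) ℝ |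
      LinearIndepOn ℝ (tangentForm B') (T : Set (Fin m × Fin n))}) :=
    hW.inter (isOpen_linearIndepOn_tangentForm _)
  refine ⟨_, hopen, ⟨B, ⟨hB.1, hB.2, hTB⟩, hB.2⟩, ?_⟩
  rintro B' ⟨hB', hB'W, hB'T⟩
  refine infinite_completions hB' (linearIndependent_rows_of_mul_transpose_eq hB' hr) hk hB'T
    ((Finset.card_le_card hTS).trans_lt hS) ?_
  filter_upwards [hopen.mem_nhds ⟨hB'W, hB'T⟩] with D hD hDsol q hq
  by_contra hspan
  have hqT : q ∉ T := fun hqT => hspan (Submodule.subset_span ⟨q, hqT, rfl⟩)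
  have h1 := hTmax (insert q T) ⟨Finset.insert_subset hq hTS, D, ⟨hDsol, hD.1⟩, by
    rw [Finset.coe_insert]
    exact hD.2.insert hspan⟩
  rw [Finset.card_insert_of_notMem hqT] at h1
  omega

/-! ### Lines, rotations and hyperplanes in Euclidean space. -/

section InnerProduct

open Module

variable {E : Type*} [NormedAddCommGroup E] [InnerProductSpace ℝ E]

/-- A line meets a sphere in at most two points. -/
theorem finite_of_sub_mem_of_norm_eq {D : Submodule ℝ E} [FiniteDimensional ℝ D]
    (hD : finrank ℝ D ≤ 1) {X : Set E} (hX : ∀ x ∈ X, ∀ y ∈ X, x - y ∈ D)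
    (hnorm : ∀ x ∈ X, ∀ y ∈ X, ‖x‖ = ‖y‖) : X.Finite := by
  obtain rfl | ⟨x, hx⟩ := X.eq_empty_or_nonempty
  · exact Set.finite_empty
  obtain ⟨⟨d, hd⟩, hdD⟩ := finrank_le_one_iff.1 hD
  refine Set.Finite.subset (Set.toFinite {x, x - (2 * inner ℝ x d / inner ℝ d d) • d}) fun y hy => ?_
  obtain ⟨c, hc⟩ := hdD ⟨y - x, hX y hy x hx⟩
  have hc' : y = x + c • d := by
    have : c • d = y - x := congrArg Subtype.val hc
    rw [this]; abel
  have h1 : inner ℝ y y = inner ℝ x x := by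
    rw [real_inner_self_eq_norm_sq, real_inner_self_eq_norm_sq, hnorm y hy x hx]
  rw [hc', inner_add_left, inner_add_right, inner_add_right, real_inner_smul_left,
    real_inner_smul_left, real_inner_smul_right, real_inner_smul_right, real_inner_comm x d] at h1
  rcases eq_or_ne (inner ℝ d d) 0 with h0 | h0
  · left
    rw [hc', inner_self_eq_zero.1 h0, smul_zero, add_zero]
  rcases eq_or_ne c 0 with rfl | hc0
  · left
    rw [hc', zero_smul, add_zero]
  · right
    have h2 : c * (2 * inner ℝ x d + c * inner ℝ d d) = 0 := by linarith
    have h3 := (mul_eq_zero.1 h2).resolve_left hc0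
    have h4 : c = -(2 * inner ℝ x d / inner ℝ d d) := by
      field_simp
      linarith
    change y = _
    rw [hc', h4, neg_smul, sub_eq_add_neg]

open Filter Topology in
theorem eventually_add_mul_cos_add_mul_sin_ne {b c : ℝ} (h : b ≠ 0 ∨ c ≠ 0) (a γ : ℝ) :
    ∀ᶠ t in 𝓝[≠] (0 : ℝ), a + b * (Real.cos t - 1) + c * Real.sin t ≠ γ := by
  have hd : ∀ t, HasDerivAt (fun t => a + b * (Real.cos t - 1) + c * Real.sin t)
      (b * (-Real.sin t) + c * Real.cos t) t := fun t =>
    (((((Real.hasDerivAt_cos t).sub_const 1).const_mul b).const_add a).add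
      ((Real.hasDerivAt_sin t).const_mul c))
  by_cases hc : c = 0
  · have hb : b ≠ 0 := h.resolve_right (not_not.2 hc)
    subst hc
    have hsin : ∀ᶠ t in 𝓝[≠] (0 : ℝ), b * (-Real.sin t) + 0 * Real.cos t ≠ 0 := by
      have := (Real.hasDerivAt_sin 0).eventually_ne (c := 0) (by simp)
      filter_upwards [this] with t ht
      simpa [hb] using ht
    by_contra hcon
    have han : AnalyticAt ℝ (fun t => a + b * (Real.cos t - 1) + 0 * Real.sin t - γ) 0 := by
      fun_prop
    rcases han.eventually_eq_zero_or_eventually_ne_zero with h0 | h0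
    · have h1 : ∀ᶠ t in 𝓝 (0 : ℝ), b * (-Real.sin t) + 0 * Real.cos t = 0 := by
        filter_upwards [h0.eventually_nhds] with t ht
        have h2 : HasDerivAt (fun t => a + b * (Real.cos t - 1) + 0 * Real.sin t - γ)
          (b * (-Real.sin t) + 0 * Real.cos t) t := (hd t).sub_const γ
        exact h2.unique ((hasDerivAt_const t (0 : ℝ)).congr_of_eventuallyEq ht)
      obtain ⟨t, h2, h3⟩ := (hsin.and (h1.filter_mono nhdsWithin_le_nhds)).exists
      exact h2 h3
    · exact hcon (h0.mono fun t ht => sub_ne_zero.1 ht)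
  · exact (hd 0).eventually_ne (by simpa using hc)

variable [FiniteDimensional ℝ E]

theorem exists_unit_orthogonal_separating {ι : Type*} [Finite ι] {M : Submodule ℝ E}
    (hM : finrank ℝ M + 2 ≤ finrank ℝ E) {u : E} (hu : u ∈ Mᗮ) {e : ι → E} (he : ∀ i, e i ∉ M) :
    ∃ v ∈ Mᗮ, ‖v‖ = 1 ∧ inner ℝ u v = 0 ∧ ∀ i, inner ℝ u (e i) ≠ 0 ∨ inner ℝ v (e i) ≠ 0 := by
  classical
  have hFmem : ∀ {v}, v ∈ (M ⊔ Submodule.span ℝ {u})ᗮ ↔ v ∈ Mᗮ ∧ inner ℝ u v = 0 := by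
    intro v
    rw [← Submodule.inf_orthogonal, Submodule.mem_inf, Submodule.mem_orthogonal_singleton_iff_inner_right]
  obtain ⟨v₀, hv₀, hv₀0⟩ : ∃ v₀ ∈ (M ⊔ Submodule.span ℝ {u})ᗮ, v₀ ≠ 0 := by
    refine Submodule.exists_mem_ne_zero_of_ne_bot fun hbot => ?_
    have h1 := Submodule.finrank_add_finrank_orthogonal (M ⊔ Submodule.span ℝ {u})
    have h2 := Submodule.finrank_add_le_finrank_add_finrank M (Submodule.span ℝ {u})
    have h3 : finrank ℝ (Submodule.span ℝ {u}) ≤ 1 := by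
      simpa using finrank_span_le_card (R := ℝ) ({u} : Set E)
    rw [hbot, finrank_bot] at h1
    omega
  -- The form at `none` forces `v ≠ 0`. Indices already separated by `u` need no condition and
  -- receive the same harmless form.
  let f : Option ι → Module.Dual ℝ E := fun o =>
    o.elim (innerₗ E v₀) fun i => if inner ℝ u (e i) = 0 then innerₗ E (e i) else innerₗ E v₀
  have hv₀f : innerₗ E v₀ v₀ ≠ 0 := inner_self_ne_zero.2 hv₀0
  obtain ⟨v, hv, hvf⟩ := Module.Dual.exists_forall_mem_ne_zero_of_forall_exists
    (M ⊔ Submodule.span ℝ {u})ᗮ f (by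
      rintro (_ | i)
      · exact ⟨v₀, hv₀, hv₀f⟩
      · by_cases hi : inner ℝ u (e i) = 0
        · refine ⟨e i - M.starProjection (e i), hFmem.2 ⟨M.sub_starProjection_mem_orthogonal _, ?_⟩, ?_⟩
          · rw [inner_sub_right, hi,
              Submodule.inner_left_of_mem_orthogonal (M.starProjection_apply_mem _) hu, sub_zero]
          · simp only [f, Option.elim, if_pos hi, innerₗ_apply_apply]
            have h1 : inner ℝ (M.starProjection (e i)) (e i - M.starProjection (e i)) = (0 : ℝ) :=
              Submodule.inner_right_of_mem_orthogonal (M.starProjection_apply_mem _)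
                (M.sub_starProjection_mem_orthogonal _)
            have h2 : inner ℝ (e i) (e i - M.starProjection (e i)) =
                inner ℝ (e i - M.starProjection (e i)) (e i - M.starProjection (e i)) := by
              rw [inner_sub_left (e i) _ (e i - M.starProjection (e i)), h1, sub_zero]
            rw [h2]
            refine inner_self_ne_zero.2 fun h0 => he i ?_
            rw [sub_eq_zero.1 h0]
            exact M.starProjection_apply_mem _
        · exact ⟨v₀, hv₀, by simpa only [f, Option.elim, if_neg hi] using hv₀f⟩)
  have hv0 : v ≠ 0 := by
    rintro rfl
    exact hvf none (map_zero _)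
  obtain ⟨hvM, hvu⟩ := hFmem.1 hv
  refine ⟨‖v‖⁻¹ • v, Submodule.smul_mem _ _ hvM, norm_smul_inv_norm hv0, ?_, fun i => ?_⟩
  · rw [real_inner_smul_right, hvu, mul_zero]
  · by_cases hi : inner ℝ u (e i) = 0
    · right
      have := hvf (some i)
      simp only [f, Option.elim, if_pos hi, innerₗ_apply_apply] at this
      rw [real_inner_smul_left, real_inner_comm]
      exact mul_ne_zero (inv_ne_zero (norm_ne_zero_iff.2 hv0)) this
    · exact Or.inl hi

open Filter Topology in
-- Rotate in the plane of `u`, the direction of the part of `x` orthogonal to `M`, and a separating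
-- `v`. Each inner product with `e i` is then a nonconstant trigonometric function of `t`.
theorem exists_rotations {ι : Type*} [Finite ι] {M : Submodule ℝ E}
    (hM : finrank ℝ M + 2 ≤ finrank ℝ E) {x : E} (hx : x ∉ M) {e : ι → E} (he : ∀ i, e i ∉ M)
    (γ : ι → ℝ) :
    ∃ R : ℝ → E → E, (∀ w, Continuous fun t => R t w) ∧ (∀ w, R 0 w = w) ∧
      (∀ t w w', inner ℝ (R t w) (R t w') = inner ℝ w w') ∧ (∀ t, ∀ w ∈ M, R t w = w) ∧
      ∀ i, ∀ᶠ t in 𝓝[≠] (0 : ℝ), inner ℝ (R t x) (e i) ≠ γ i := by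
  set z := x - M.starProjection x
  have hz : z ∈ Mᗮ := M.sub_starProjection_mem_orthogonal _
  have hz0 : z ≠ 0 := fun h0 => hx (by
    rw [sub_eq_zero.1 h0]
    exact M.starProjection_apply_mem _)
  obtain ⟨u, hu, hu1, hzu⟩ : ∃ u ∈ Mᗮ, ‖u‖ = 1 ∧ z = ‖z‖ • u :=
    ⟨‖z‖⁻¹ • z, Submodule.smul_mem _ _ hz, norm_smul_inv_norm hz0,
      (smul_inv_smul₀ (norm_ne_zero_iff.2 hz0) z).symm⟩
  obtain ⟨v, hv, hv1, huv, huve⟩ := exists_unit_orthogonal_separating hM hu he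
  have huu : inner ℝ u u = (1 : ℝ) := by rw [real_inner_self_eq_norm_sq, hu1, one_pow]
  have hvv : inner ℝ v v = (1 : ℝ) := by rw [real_inner_self_eq_norm_sq, hv1, one_pow]
  have hvu : inner ℝ v u = (0 : ℝ) := by rw [real_inner_comm, huv]
  have hxz : x = M.starProjection x + ‖z‖ • u := by rw [← hzu]; simp [z]
  have hux : inner ℝ u x = ‖z‖ := by
    rw [hxz, inner_add_right,
      Submodule.inner_left_of_mem_orthogonal (M.starProjection_apply_mem _) hu,
      real_inner_smul_right, huu, zero_add, mul_one]
  have hvx : inner ℝ v x = (0 : ℝ) := by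
    rw [hxz, inner_add_right,
      Submodule.inner_left_of_mem_orthogonal (M.starProjection_apply_mem _) hv,
      real_inner_smul_right, hvu, zero_add, mul_zero]
  refine ⟨fun t w => w + ((Real.cos t - 1) * inner ℝ u w - Real.sin t * inner ℝ v w) • u +
    ((Real.cos t - 1) * inner ℝ v w + Real.sin t * inner ℝ u w) • v, fun w => by fun_prop,
    fun w => by simp, fun t w w' => ?_, fun t w hw => ?_, fun i => ?_⟩
  · simp only [inner_add_left, inner_add_right, real_inner_smul_left, real_inner_smul_right, huu,
      hvv, huv, hvu, real_inner_comm u w, real_inner_comm v w]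
    have := Real.sin_sq_add_cos_sq t
    linear_combination (inner ℝ u w * inner ℝ u w' + inner ℝ v w * inner ℝ v w') * this
  · simp only [Submodule.inner_left_of_mem_orthogonal hw hu,
      Submodule.inner_left_of_mem_orthogonal hw hv]
    simp
  · have h1 : ‖z‖ * inner ℝ u (e i) ≠ 0 ∨ ‖z‖ * inner ℝ v (e i) ≠ 0 :=
      (huve i).imp (mul_ne_zero (norm_ne_zero_iff.2 hz0)) (mul_ne_zero (norm_ne_zero_iff.2 hz0))
    filter_upwards [eventually_add_mul_cos_add_mul_sin_ne h1 (inner ℝ x (e i)) (γ i)] with t ht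
    simp only [inner_add_left, real_inner_smul_left, hux, hvx]
    convert ht using 1
    ring

/-- The sum of `(M ⊔ Y')ᗮ` and `M` has dimension at least `finrank ℝ M + 2`, so it meets `Y`; `μ` is
the `M`-part of a common vector. -/
theorem exists_mem_inner_eq_inner {M Y Y' : Submodule ℝ E}
    (h1 : finrank ℝ M + finrank ℝ Y' + 2 ≤ finrank ℝ E)
    (h2 : finrank ℝ E < finrank ℝ Y + finrank ℝ M + 2) :
    ∃ e ∈ Y, e ≠ 0 ∧ ∃ μ ∈ M, ∀ x ∈ M ⊔ Y', inner ℝ x e = inner ℝ x μ := by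
  have hdisj : (M ⊔ Y')ᗮ ⊓ M = ⊥ := by
    rw [← disjoint_iff]
    exact ((M ⊔ Y').orthogonal_disjoint.mono_left le_sup_left).symm
  have h3 := Submodule.finrank_sup_add_finrank_inf_eq (M ⊔ Y')ᗮ M
  rw [hdisj, finrank_bot] at h3
  have h4 := Submodule.finrank_add_finrank_orthogonal (M ⊔ Y')
  have h5 := Submodule.finrank_add_le_finrank_add_finrank M Y'
  have h6 := Submodule.finrank_sup_add_finrank_inf_eq ((M ⊔ Y')ᗮ ⊔ M) Y
  have h7 := Submodule.finrank_le ((M ⊔ Y')ᗮ ⊔ M ⊔ Y)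
  obtain ⟨e, he, he0⟩ : ∃ e ∈ ((M ⊔ Y')ᗮ ⊔ M) ⊓ Y, e ≠ 0 := by
    refine Submodule.exists_mem_ne_zero_of_ne_bot fun hbot => ?_
    rw [hbot, finrank_bot] at h6
    omega
  obtain ⟨v, hv, μ, hμ, rfl⟩ := Submodule.mem_sup.1 he.1
  refine ⟨_, he.2, he0, μ, hμ, fun x hx => ?_⟩
  rw [inner_add_right, Submodule.inner_right_of_mem_orthogonal hx hv, zero_add]

end InnerProduct

/-! ### Row-by-row finiteness for staircase positions. -/

/-- The vectors that vanish outside the first `k` coordinates. -/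
def leadingSubspace (n k : ℕ) : Submodule ℝ (EuclideanSpace ℝ (Fin n)) where
  carrier := {x | ∀ c : Fin n, k ≤ c → x c = 0}
  add_mem' hx hy c hc := by simp [hx c hc, hy c hc]
  zero_mem' _ _ := rfl
  smul_mem' a x hx c hc := by simp [hx c hc]

theorem leadingSubspace_mono (n : ℕ) {k l : ℕ} (h : k ≤ l) :
    leadingSubspace n k ≤ leadingSubspace n l := fun _ hx c hc => hx c (h.trans hc)

theorem finrank_leadingSubspace {n k : ℕ} (h : k ≤ n) :
    Module.finrank ℝ (leadingSubspace n k) = k := by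
  let f : leadingSubspace n k ≃ₗ[ℝ] (Fin k → ℝ) :=
    { toFun := fun x i => x.1 (Fin.castLE h i)
      map_add' := fun _ _ => rfl
      map_smul' := fun _ _ => rfl
      invFun := fun y => ⟨WithLp.toLp 2 fun c => if hc : (c : ℕ) < k then y ⟨c, hc⟩ else 0,
        fun c hc => dif_neg hc.not_gt⟩
      left_inv := fun x => by
        ext c
        by_cases hc : (c : ℕ) < k
        · simp [hc]
        · simp [hc, x.2 c (not_lt.1 hc)]
      right_inv := fun y => by
        ext i
        simp }
  rw [f.finrank_eq, Module.finrank_fin_fun]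

section Rows

variable {m n : ℕ}

/-- The rows `r i` of `B` with `i < j`, padded by zeros. -/
noncomputable def rowsBelow (r : Fin (n - 1) → Fin m) (j : ℕ) (B : Matrix (Fin m) (Fin n) ℝ) :
    Fin (n - 1) → EuclideanSpace ℝ (Fin n) :=
  fun i => if (i : ℕ) < j then WithLp.toLp 2 (B (r i)) else 0

/-- `B` and `B'` agree in the rows `r i` with `i < j` on the first `n - 1 - i` columns. -/
def AgreeBelow (r : Fin (n - 1) → Fin m) (j : ℕ) (B B' : Matrix (Fin m) (Fin n) ℝ) : Prop :=
  ∀ i : Fin (n - 1), (i : ℕ) < j → ∀ c : Fin n, (c : ℕ) + 1 + i < n → B' (r i) c = B (r i) c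

/-- No nontrivial combination of the rows `r i` of `B` with `i < j` vanishes on the last `j + 1`
columns. -/
def NondegenerateBelow (r : Fin (n - 1) → Fin m) (j : ℕ) (B : Matrix (Fin m) (Fin n) ℝ) : Prop :=
  Disjoint (Submodule.span ℝ (Set.range (rowsBelow r j B))) (leadingSubspace n (n - 1 - j))

/-- All solutions that agree with `B` in the rows `r i` with `i < j` on the first `n - 1 - i`
columns. -/
def completionsBelow (C : Matrix (Fin m) (Fin m) ℝ) (r : Fin (n - 1) → Fin m) (j : ℕ)
    (B : Matrix (Fin m) (Fin n) ℝ) : Set (Matrix (Fin m) (Fin n) ℝ) :=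
  {B' | B' ∈ solutionSet n C ∧ AgreeBelow r j B B'}

variable {C : Matrix (Fin m) (Fin m) ℝ} {r : Fin (n - 1) → Fin m} {j : ℕ}
  {B B' : Matrix (Fin m) (Fin n) ℝ}

theorem inner_row_row (hB : B ∈ solutionSet n C) (a b : Fin m) :
    inner ℝ (WithLp.toLp 2 (B a) : EuclideanSpace ℝ (Fin n)) (WithLp.toLp 2 (B b)) = C a b := by
  rw [← show B * Bᵀ = C from hB, EuclideanSpace.inner_eq_star_dotProduct, dotProduct_comm]
  rfl

theorem AgreeBelow.mono {i : ℕ} (h : AgreeBelow r j B B') (hij : i ≤ j) : AgreeBelow r i B B' :=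
  fun a ha => h a (ha.trans_le hij)

theorem rowsBelow_succ (hj : j < n - 1) (B : Matrix (Fin m) (Fin n) ℝ) :
    rowsBelow r (j + 1) B =
      Function.update (rowsBelow r j B) ⟨j, hj⟩ (WithLp.toLp 2 (B (r ⟨j, hj⟩))) := by
  ext1 i
  rcases eq_or_ne i ⟨j, hj⟩ with rfl | hi
  · simp [rowsBelow]
  · have : (i : ℕ) ≠ j := fun h => hi (Fin.ext h)
    rw [Function.update_of_ne hi, rowsBelow, rowsBelow]
    congr 1
    exact propext (by omega)

theorem span_rowsBelow_succ_le (hj : j < n - 1) (B : Matrix (Fin m) (Fin n) ℝ) :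
    Submodule.span ℝ (Set.range (rowsBelow r (j + 1) B)) ≤
      Submodule.span ℝ (Set.range (rowsBelow r j B)) ⊔
        Submodule.span ℝ {WithLp.toLp 2 (B (r ⟨j, hj⟩))} := by
  rw [Submodule.span_le, rowsBelow_succ hj]
  rintro _ ⟨i, rfl⟩
  rcases eq_or_ne i ⟨j, hj⟩ with rfl | hi
  · rw [Function.update_self]
    exact Submodule.mem_sup_right (Submodule.mem_span_singleton_self _)
  · rw [Function.update_of_ne hi]
    exact Submodule.mem_sup_left (Submodule.subset_span ⟨i, rfl⟩)

theorem linearIndependent_toLp_rows (hr : LinearIndependent ℝ fun i => B (r i)) :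
    LinearIndependent ℝ
      fun i => (WithLp.toLp 2 (B (r i)) : EuclideanSpace ℝ (Fin n)) :=
  hr.map' (WithLp.linearEquiv 2 ℝ (Fin n → ℝ)).symm.toLinearMap (LinearEquiv.ker _)

theorem finrank_span_rowsBelow (hr : LinearIndependent ℝ fun i => B (r i)) (hj : j ≤ n - 1) :
    Module.finrank ℝ (Submodule.span ℝ (Set.range (rowsBelow r j B))) = j := by
  have h1 : Submodule.span ℝ (Set.range (rowsBelow r j B)) = Submodule.span ℝ
      (Set.range fun i : Fin j =>
        (WithLp.toLp 2 (B (r (Fin.castLE hj i))) : EuclideanSpace ℝ (Fin n))) := by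
    apply le_antisymm
    · rw [Submodule.span_le]
      rintro _ ⟨i, rfl⟩
      by_cases hi : (i : ℕ) < j
      · rw [rowsBelow, if_pos hi]
        exact Submodule.subset_span ⟨⟨i, hi⟩, rfl⟩
      · rw [rowsBelow, if_neg hi]
        exact Submodule.zero_mem _
    · refine Submodule.span_mono ?_
      rintro _ ⟨i, rfl⟩
      exact ⟨Fin.castLE hj i, if_pos i.2⟩
  rw [h1]
  exact (finrank_span_eq_card ((linearIndependent_toLp_rows hr).comp _
    (Fin.castLE_injective hj))).trans (Fintype.card_fin j)

theorem row_notMem_span_rowsBelow (hr : LinearIndependent ℝ fun i => B (r i)) (hj : j < n - 1) :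
    WithLp.toLp 2 (B (r ⟨j, hj⟩)) ∉ Submodule.span ℝ (Set.range (rowsBelow r j B)) := by
  intro h
  have h1 := Submodule.finrank_mono ((span_rowsBelow_succ_le (r := r) hj B).trans
    (sup_le le_rfl ((Submodule.span_singleton_le_iff_mem _ _).2 h)))
  rw [finrank_span_rowsBelow hr hj, finrank_span_rowsBelow hr hj.le] at h1
  omega

theorem inner_row_eq_of_rowsBelow_eq (hB : B ∈ solutionSet n C) (hB' : B' ∈ solutionSet n C)
    (h : rowsBelow r j B = rowsBelow r j B') (a : Fin m) {μ : EuclideanSpace ℝ (Fin n)}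
    (hμ : μ ∈ Submodule.span ℝ (Set.range (rowsBelow r j B))) :
    inner ℝ (WithLp.toLp 2 (B a)) μ = inner ℝ (WithLp.toLp 2 (B' a)) μ := by
  refine Submodule.span_induction (p := fun μ _ =>
    inner ℝ (WithLp.toLp 2 (B a)) μ = inner ℝ (WithLp.toLp 2 (B' a)) μ) ?_ ?_ ?_ ?_ hμ
  · rintro _ ⟨i, rfl⟩
    by_cases hi : (i : ℕ) < j
    · conv_rhs => rw [h]
      rw [rowsBelow, rowsBelow, if_pos hi, if_pos hi, inner_row_row hB, inner_row_row hB']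
    · rw [rowsBelow, if_neg hi, inner_zero_right, inner_zero_right]
  · rw [inner_zero_right, inner_zero_right]
  · intro y z _ _ hy hz; rw [inner_add_right, inner_add_right, hy, hz]
  · intro c y _ hy; rw [real_inner_smul_right, real_inner_smul_right, hy]

/-- Two candidates differ by a vector orthogonal to the rows below `j` and to the leading subspace.
Nondegeneracy makes their sum a space of dimension `n - 1`, and `C` fixes the norm. -/
theorem finite_image_row {A : Matrix (Fin m) (Fin n) ℝ}
    (hr : LinearIndependent ℝ fun i => A (r i)) (hj : j ≤ n - 1) (a : Fin m)
    {F : Set (Matrix (Fin m) (Fin n) ℝ)} (hF : F ⊆ solutionSet n (A * Aᵀ))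
    (hrows : ∀ B ∈ F, ∀ B' ∈ F, rowsBelow r j B = rowsBelow r j B')
    (hagree : ∀ B ∈ F, ∀ B' ∈ F, ∀ c : Fin n, (c : ℕ) < n - 1 - j → B a c = B' a c)
    (hnd : ∀ B ∈ F, NondegenerateBelow r j B) :
    ((fun B : Matrix (Fin m) (Fin n) ℝ =>
      (WithLp.toLp 2 (B a) : EuclideanSpace ℝ (Fin n))) '' F).Finite := by
  obtain rfl | ⟨B₀, hB₀⟩ := F.eq_empty_or_nonempty
  · simp
  refine finite_of_sub_mem_of_norm_eq (D := (Submodule.span ℝ (Set.range (rowsBelow r j B₀)) ⊔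
    leadingSubspace n (n - 1 - j))ᗮ) ?_ ?_ ?_
  · have h1 := Submodule.finrank_add_finrank_orthogonal
      (Submodule.span ℝ (Set.range (rowsBelow r j B₀)) ⊔ leadingSubspace n (n - 1 - j))
    have h2 := Submodule.finrank_sup_add_finrank_inf_eq
      (Submodule.span ℝ (Set.range (rowsBelow r j B₀))) (leadingSubspace n (n - 1 - j))
    rw [disjoint_iff.1 (hnd B₀ hB₀), finrank_bot, finrank_leadingSubspace (by omega),
      finrank_span_rowsBelow (linearIndependent_rows_of_mul_transpose_eq (hF hB₀) hr) hj] at h2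
    rw [finrank_euclideanSpace_fin] at h1
    omega
  · rintro _ ⟨B, hB, rfl⟩ _ ⟨B', hB', rfl⟩
    rw [Submodule.mem_orthogonal']
    intro x hx
    obtain ⟨μ, hμ, y, hy, rfl⟩ := Submodule.mem_sup.1 hx
    rw [hrows B₀ hB₀ B hB] at hμ
    rw [inner_add_right, inner_sub_left, inner_sub_left,
      inner_row_eq_of_rowsBelow_eq (hF hB) (hF hB') (hrows B hB B' hB') a hμ, sub_self, zero_add,
      ← inner_sub_left, PiLp.inner_apply]
    refine Finset.sum_eq_zero fun c _ => ?_
    by_cases hc : (c : ℕ) < n - 1 - j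
    · simp [hagree B hB B' hB' c hc]
    · simp [hy c (not_lt.1 hc)]
  · rintro _ ⟨B, hB, rfl⟩ _ ⟨B', hB', rfl⟩
    rw [← sq_eq_sq₀ (norm_nonneg _) (norm_nonneg _), ← real_inner_self_eq_norm_sq,
      ← real_inner_self_eq_norm_sq, inner_row_row (hF hB), inner_row_row (hF hB')]

theorem finite_image_rowsBelow {A : Matrix (Fin m) (Fin n) ℝ}
    (hr : LinearIndependent ℝ fun i => A (r i)) (hj : j ≤ n - 1)
    (hB : ∀ i < j, ∀ B' ∈ completionsBelow (A * Aᵀ) r i B, NondegenerateBelow r i B') :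
    (rowsBelow r j '' completionsBelow (A * Aᵀ) r j B).Finite := by
  induction j with
  | zero =>
    refine (Set.finite_singleton 0).subset ?_
    rintro _ ⟨B', _, rfl⟩
    ext1 i
    exact if_neg (Nat.not_lt_zero _)
  | succ j ih =>
    have hfin := ih (by omega) fun i hi => hB i (by omega)
    refine (hfin.biUnion (t := fun ρ => (fun x => Function.update ρ ⟨j, hj⟩ x) ''
      ((fun B' : Matrix (Fin m) (Fin n) ℝ => WithLp.toLp 2 (B' (r ⟨j, hj⟩))) ''
        {B' | B' ∈ completionsBelow (A * Aᵀ) r (j + 1) B ∧ rowsBelow r j B' = ρ}))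
      fun ρ _ => Set.Finite.image _ ?_).subset ?_
    · refine finite_image_row hr (j := j) (by omega) _ (fun B' hB' => hB'.1.1)
        (fun B' hB' B'' hB'' => hB'.2.trans hB''.2.symm) ?_
        fun B' hB' => hB j (by omega) B' ⟨hB'.1.1, hB'.1.2.mono (by omega)⟩
      intro B' hB' B'' hB'' c hc
      have hc' : (c : ℕ) + 1 + j < n := by omega
      rw [hB'.1.2 ⟨j, hj⟩ (Nat.lt_succ_self j) c hc', hB''.1.2 ⟨j, hj⟩ (Nat.lt_succ_self j) c hc']
    · rintro _ ⟨B', hB', rfl⟩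
      refine Set.mem_biUnion (x := rowsBelow r j B') ⟨B', ⟨hB'.1, hB'.2.mono (by omega)⟩, rfl⟩ ?_
      exact ⟨_, ⟨B', ⟨hB', rfl⟩, rfl⟩, (rowsBelow_succ hj B').symm⟩

theorem finite_completionsBelow {A : Matrix (Fin m) (Fin n) ℝ}
    (hr : LinearIndependent ℝ fun i => A (r i))
    (hB : ∀ i < n - 1, ∀ B' ∈ completionsBelow (A * Aᵀ) r i B, NondegenerateBelow r i B') :
    (completionsBelow (A * Aᵀ) r (n - 1) B).Finite := by
  have hfin := finite_image_rowsBelow hr le_rfl hB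
  let G := fun ρ => {B' | B' ∈ completionsBelow (A * Aᵀ) r (n - 1) B ∧ rowsBelow r (n - 1) B' = ρ}
  refine (hfin.biUnion (t := G) fun ρ _ => ?_).subset fun B' hB' =>
    Set.mem_biUnion ⟨B', hB', rfl⟩ ⟨hB', rfl⟩
  have hrow : ∀ a, ((fun B' : Matrix (Fin m) (Fin n) ℝ =>
      (WithLp.toLp 2 (B' a) : EuclideanSpace ℝ (Fin n))) '' G ρ).Finite := fun a => by
    refine finite_image_row hr le_rfl a (fun B' hB' => hB'.1.1)
      (fun B' hB' B'' hB'' => hB'.2.trans hB''.2.symm) (fun B' _ B'' _ c hc => by omega)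
      fun B' _ => ?_
    have hbot : leadingSubspace n (n - 1 - (n - 1)) = ⊥ := by
      rw [eq_bot_iff]
      intro x hx
      ext c
      exact hx c (by omega)
    rw [NondegenerateBelow, hbot]
    exact disjoint_bot_right
  refine Set.Finite.of_finite_image ((Set.Finite.pi' hrow).subset ?_)
    (f := fun (B' : Matrix (Fin m) (Fin n) ℝ) a =>
      (WithLp.toLp 2 (B' a) : EuclideanSpace ℝ (Fin n))) ?_
  · rintro _ ⟨B', hB', rfl⟩ a
    exact ⟨B', hB', rfl⟩
  · intro B' _ B'' _ h
    ext a c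
    exact congrFun (congrArg WithLp.ofLp (congrFun h a)) c

end Rows

/-! ### Degeneracy is a closed condition. -/

section Rows

variable {m n : ℕ} {C : Matrix (Fin m) (Fin m) ℝ} {r : Fin (n - 1) → Fin m} {j : ℕ}
  {A B B' : Matrix (Fin m) (Fin n) ℝ}

theorem isCompact_solutionSet (n : ℕ) (C : Matrix (Fin m) (Fin m) ℝ) :
    IsCompact (solutionSet n C) := by
  have hK : IsCompact (Set.univ.pi fun i : Fin m => Set.univ.pi fun _ : Fin n =>
      Set.Icc (-√(C i i)) (√(C i i))) :=
    isCompact_univ_pi fun i => isCompact_univ_pi fun _ => isCompact_Icc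
  refine hK.of_isClosed_subset ?_ ?_
  · have hc : Continuous fun B : Matrix (Fin m) (Fin n) ℝ => B * Bᵀ := by fun_prop
    exact isClosed_eq hc continuous_const
  · intro (B : Matrix (Fin m) (Fin n) ℝ) hB i _ c _
    refine abs_le.1 (Real.abs_le_sqrt ?_)
    rw [← show B * Bᵀ = C from hB, Matrix.mul_apply]
    simp only [Matrix.transpose_apply, ← pow_two]
    exact Finset.single_le_sum (f := fun c => B i c ^ 2) (fun c _ => sq_nonneg _) (Finset.mem_univ c)

/-- Normalizing the coefficients puts the witness of degeneracy in a compact set, so that the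
witness can be projected away in a closedness proof. -/
theorem not_nondegenerateBelow_iff (hr : LinearIndependent ℝ fun i => B (r i)) :
    ¬ NondegenerateBelow r j B ↔ ∃ β : Fin (n - 1) → ℝ, β ∈ Metric.sphere 0 1 ∧
      (∀ i : Fin (n - 1), j ≤ i → β i = 0) ∧
      ∀ c : Fin n, n - 1 - j ≤ c → ∑ i, β i * B (r i) c = 0 := by
  have hsum : ∀ (g : Fin (n - 1) → ℝ) (c : Fin n),
      (∑ i, g i • rowsBelow r j B i) c = ∑ i : Fin (n - 1), (if (i : ℕ) < j then g i else 0) * B (r i) c := by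
    intro g c
    rw [WithLp.ofLp_sum, Finset.sum_apply]
    refine Finset.sum_congr rfl fun i _ => ?_
    by_cases hi : (i : ℕ) < j <;> simp [rowsBelow, hi]
  have hli := linearIndependent_toLp_rows hr
  constructor
  · intro h
    rw [NondegenerateBelow, Submodule.disjoint_def] at h
    push Not at h
    obtain ⟨x, hx, hxY, hx0⟩ := h
    obtain ⟨g, rfl⟩ := (Submodule.mem_span_range_iff_exists_fun ℝ).1 hx
    set β : Fin (n - 1) → ℝ := fun i => if (i : ℕ) < j then g i else 0
    have hβ0 : β ≠ 0 := by
      intro h0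
      apply hx0
      ext c
      rw [hsum]
      refine Finset.sum_eq_zero fun i _ => ?_
      rw [show (if (i : ℕ) < j then g i else 0) = 0 from congrFun h0 i, zero_mul]
    refine ⟨‖β‖⁻¹ • β, ?_, fun i hi => ?_, fun c hc => ?_⟩
    · rw [mem_sphere_zero_iff_norm]
      exact norm_smul_inv_norm (𝕜 := ℝ) hβ0
    · rw [Pi.smul_apply, show β i = 0 from if_neg hi.not_gt, smul_zero]
    · have := hxY c hc
      rw [hsum] at this
      simp only [Pi.smul_apply, smul_eq_mul, mul_assoc, ← Finset.mul_sum]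
      rw [this, mul_zero]
  · rintro ⟨β, hβ, hβj, hβB⟩ hnd
    have hβ' : ∀ i : Fin (n - 1), (if (i : ℕ) < j then β i else 0) = β i := fun i => by
      split_ifs with h
      · rfl
      · exact (hβj i (not_lt.1 h)).symm
    have h0 : ∑ i, β i • rowsBelow r j B i = 0 := by
      refine Submodule.disjoint_def.1 hnd _
        ((Submodule.mem_span_range_iff_exists_fun ℝ).2 ⟨β, rfl⟩) fun c hc => ?_
      rw [hsum]
      simpa only [hβ'] using hβB c hc
    have h1 : β = 0 := by
      ext i
      refine Fintype.linearIndependent_iff.1 hli β ?_ i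
      rw [← h0]
      refine Finset.sum_congr rfl fun i _ => ?_
      by_cases hi : (i : ℕ) < j
      · rw [rowsBelow, if_pos hi]
      · rw [hβj i (not_lt.1 hi), zero_smul, zero_smul]
    rw [h1] at hβ
    simp at hβ

theorem isClosed_exists_degenerate_completion (hr : LinearIndependent ℝ fun i => A (r i)) (j : ℕ) :
    IsClosed {B | B ∈ solutionSet n (A * Aᵀ) ∧
      ∃ B' ∈ completionsBelow (A * Aᵀ) r j B, ¬ NondegenerateBelow r j B'} := by
  let K : Set ((Matrix (Fin m) (Fin n) ℝ × Matrix (Fin m) (Fin n) ℝ) × (Fin (n - 1) → ℝ)) :=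
    ((solutionSet n (A * Aᵀ) ×ˢ solutionSet n (A * Aᵀ)) ×ˢ Metric.sphere 0 1) ∩
      {p | AgreeBelow r j p.1.1 p.1.2 ∧ (∀ i : Fin (n - 1), j ≤ i → p.2 i = 0) ∧
        ∀ c : Fin n, n - 1 - j ≤ c → ∑ i, p.2 i * p.1.2 (r i) c = 0}
  have hK : IsCompact K := by
    refine (((isCompact_solutionSet _ _).prod (isCompact_solutionSet _ _)).prod
      (isCompact_sphere _ _)).inter_right ?_
    have he1 : ∀ a c, Continuous fun p : (Matrix (Fin m) (Fin n) ℝ × Matrix (Fin m) (Fin n) ℝ) ×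
        (Fin (n - 1) → ℝ) => p.1.1 a c := fun a c =>
      continuous_fst.fst.matrix_elem a c
    have he2 : ∀ a c, Continuous fun p : (Matrix (Fin m) (Fin n) ℝ × Matrix (Fin m) (Fin n) ℝ) ×
        (Fin (n - 1) → ℝ) => p.1.2 a c := fun a c =>
      continuous_fst.snd.matrix_elem a c
    have he3 : ∀ i, Continuous fun p : (Matrix (Fin m) (Fin n) ℝ × Matrix (Fin m) (Fin n) ℝ) ×
        (Fin (n - 1) → ℝ) => p.2 i := fun i => (continuous_apply i).comp continuous_snd
    simp only [AgreeBelow, Set.ofPred_and, Set.ofPred_forall]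
    refine IsClosed.inter ?_ (IsClosed.inter ?_ ?_)
    · exact isClosed_iInter fun i => isClosed_iInter fun _ => isClosed_iInter fun c =>
        isClosed_iInter fun _ => isClosed_eq (he2 _ _) (he1 _ _)
    · exact isClosed_iInter fun i => isClosed_iInter fun _ => isClosed_eq (he3 i) continuous_const
    · exact isClosed_iInter fun c => isClosed_iInter fun _ =>
        isClosed_eq (continuous_finsetSum _ fun i _ => (he3 i).mul (he2 _ _)) continuous_const
  convert (hK.image continuous_fst.fst).isClosed using 1
  ext B
  constructor
  · rintro ⟨hB, B', ⟨hB', hag⟩, hnd⟩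
    obtain ⟨β, h1, h2, h3⟩ :=
      (not_nondegenerateBelow_iff (linearIndependent_rows_of_mul_transpose_eq hB' hr)).1 hnd
    exact ⟨((B, B'), β), ⟨⟨⟨hB, hB'⟩, h1⟩, hag, h2, h3⟩, rfl⟩
  · rintro ⟨⟨⟨B, B'⟩, β⟩, ⟨⟨⟨hB, hB'⟩, h1⟩, hag, h2, h3⟩, rfl⟩
    exact ⟨hB, B', ⟨hB', hag⟩,
      (not_nondegenerateBelow_iff (linearIndependent_rows_of_mul_transpose_eq hB' hr)).2
        ⟨β, h1, h2, h3⟩⟩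

/-- For a solution `B'` with nondegenerate rows below `j`, the degenerate choices of the row `r j`
lie in an affine hyperplane that only depends on the rows below `j` and only involves the first
`n - 1 - j` entries. -/
theorem exists_separating_form (hr : LinearIndependent ℝ fun i => A (r i)) (hj : j + 1 < n - 1)
    {F : Set (Matrix (Fin m) (Fin n) ℝ)} (hF : F ⊆ solutionSet n (A * Aᵀ))
    (hnd : ∀ B ∈ F, NondegenerateBelow r j B) {ρ : Fin (n - 1) → EuclideanSpace ℝ (Fin n)}
    (hρ : ρ ∈ rowsBelow r j '' F) :
    ∃ e ∈ leadingSubspace n (n - 1 - j), e ≠ 0 ∧ ∃ γ : ℝ, ∀ B ∈ F, rowsBelow r j B = ρ →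
      ¬ NondegenerateBelow r (j + 1) B →
        inner ℝ (WithLp.toLp 2 (B (r ⟨j, by omega⟩))) e = γ := by
  obtain ⟨B₀, hB₀, rfl⟩ := hρ
  have hfr := finrank_span_rowsBelow (linearIndependent_rows_of_mul_transpose_eq (hF hB₀) hr)
    (show j ≤ n - 1 by omega)
  obtain ⟨e, he, he0, μ, hμ, h⟩ := exists_mem_inner_eq_inner
    (M := Submodule.span ℝ (Set.range (rowsBelow r j B₀))) (Y := leadingSubspace n (n - 1 - j))
    (Y' := leadingSubspace n (n - 1 - (j + 1)))
    (by rw [hfr, finrank_leadingSubspace (by omega), finrank_euclideanSpace_fin]; omega)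
    (by rw [hfr, finrank_leadingSubspace (by omega), finrank_euclideanSpace_fin]; omega)
  refine ⟨e, he, he0, inner ℝ (WithLp.toLp 2 (B₀ (r ⟨j, by omega⟩))) μ, fun B hB hBρ hdeg => ?_⟩
  rw [← inner_row_eq_of_rowsBelow_eq (hF hB) (hF hB₀) hBρ _ (hBρ ▸ hμ)]
  apply h
  rw [NondegenerateBelow, Submodule.disjoint_def] at hdeg
  push Not at hdeg
  obtain ⟨x, hx, hxY, hx0⟩ := hdeg
  obtain ⟨y, hy, z, hz, rfl⟩ := Submodule.mem_sup.1 (span_rowsBelow_succ_le (by omega) B hx)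
  obtain ⟨c, rfl⟩ := Submodule.mem_span_singleton.1 hz
  -- Otherwise the degeneracy would already occur among the rows below `j`.
  have hc : c ≠ 0 := by
    rintro rfl
    rw [zero_smul, add_zero] at hxY hx0
    exact hx0 (Submodule.disjoint_def.1 (hnd B hB) y hy
      (leadingSubspace_mono n (by omega) hxY))
  have h1 : (WithLp.toLp 2 (B (r ⟨j, by omega⟩)) : EuclideanSpace ℝ (Fin n)) =
      c⁻¹ • (-y + (y + c • WithLp.toLp 2 (B (r ⟨j, by omega⟩)))) := by
    rw [neg_add_cancel_left, inv_smul_smul₀ hc]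
  rw [h1]
  exact Submodule.smul_mem _ _ (Submodule.add_mem _
    (Submodule.mem_sup_left (Submodule.neg_mem _ (hBρ ▸ hy))) (Submodule.mem_sup_right hxY))

end Rows

/-! ### Density of nondegeneracy and the staircase count. -/

section Rows

variable {m n : ℕ} {r : Fin (n - 1) → Fin m} {j : ℕ} {A B : Matrix (Fin m) (Fin n) ℝ}

theorem nondegenerateBelow_zero (r : Fin (n - 1) → Fin m) (B : Matrix (Fin m) (Fin n) ℝ) :
    NondegenerateBelow r 0 B := by
  have h : Submodule.span ℝ (Set.range (rowsBelow r 0 B)) = ⊥ := by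
    rw [Submodule.span_eq_bot]
    rintro _ ⟨i, rfl⟩
    exact if_neg (Nat.not_lt_zero _)
  rw [NondegenerateBelow, h]
  exact disjoint_bot_left

open Filter Topology in
-- Rotating all rows preserves the Gram matrix, and fixing the rows below `j` keeps later
-- completions inside `F`. Only finitely many row tuples occur in `F`, so finitely many hyperplanes
-- must be avoided.
theorem exists_nondegenerate_perturbation (hr : LinearIndependent ℝ fun i => A (r i))
    (hj : j + 1 < n - 1) (hB : B ∈ solutionSet n (A * Aᵀ))
    (hnd : ∀ i ≤ j, ∀ B' ∈ completionsBelow (A * Aᵀ) r i B, NondegenerateBelow r i B')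
    {W : Set (Matrix (Fin m) (Fin n) ℝ)} (hW : IsOpen W) (hBW : B ∈ W) :
    ∃ D ∈ solutionSet n (A * Aᵀ) ∩ W,
      ∀ B' ∈ completionsBelow (A * Aᵀ) r (j + 1) D, NondegenerateBelow r (j + 1) B' := by
  have hrB := linearIndependent_rows_of_mul_transpose_eq hB hr
  set F := completionsBelow (A * Aᵀ) r j B
  have hFX : F ⊆ solutionSet n (A * Aᵀ) := fun B' hB' => hB'.1
  have : Finite (rowsBelow r j '' F) :=
    finite_image_rowsBelow hr (by omega) fun i hi => hnd i hi.le
  choose e heY he0 γ hγ using fun ρ : rowsBelow r j '' F =>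
    exists_separating_form hr hj hFX (hnd j le_rfl) ρ.2
  have heM : ∀ ρ, e ρ ∉ Submodule.span ℝ (Set.range (rowsBelow r j B)) := fun ρ hρ =>
    he0 ρ (Submodule.disjoint_def.1 (hnd j le_rfl B ⟨hB, fun _ _ _ _ => rfl⟩) _ hρ (heY ρ))
  obtain ⟨R, hRc, hR0, hRi, hRM, hRγ⟩ := exists_rotations
    (by rw [finrank_span_rowsBelow hrB (by omega), finrank_euclideanSpace_fin]; omega)
    (row_notMem_span_rowsBelow hrB (show j < n - 1 by omega)) heM γ
  let D : ℝ → Matrix (Fin m) (Fin n) ℝ := fun t => Matrix.of fun a c => R t (WithLp.toLp 2 (B a)) c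
  have hDc : Continuous D := continuous_matrix fun a c =>
    (EuclideanSpace.proj c : EuclideanSpace ℝ (Fin n) →L[ℝ] ℝ).continuous.comp (hRc _)
  have hD0 : D 0 = B := by
    ext a c
    simp [D, hR0]
  have hDX : ∀ t, D t ∈ solutionSet n (A * Aᵀ) := by
    intro t
    rw [← show B * Bᵀ = A * Aᵀ from hB]
    change D t * (D t)ᵀ = _
    ext a b
    rw [← inner_row_row (C := B * Bᵀ) rfl a b, ← hRi t, real_inner_comm,
      EuclideanSpace.inner_eq_star_dotProduct]
    rfl
  have hDW : ∀ᶠ t in 𝓝[≠] (0 : ℝ), D t ∈ W :=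
    (hDc.continuousAt.eventually (hW.mem_nhds (by rwa [hD0]))).filter_mono nhdsWithin_le_nhds
  obtain ⟨t, htW, htγ⟩ := (hDW.and (eventually_all.2 hRγ)).exists
  refine ⟨D t, ⟨hDX t, htW⟩, fun B' hB' => ?_⟩
  have hB'F : B' ∈ F := by
    refine ⟨hB'.1, fun i hi c hc => ?_⟩
    rw [hB'.2 i (by omega) c hc]
    change R t (WithLp.toLp 2 (B (r i))) c = _
    rw [hRM t _ (Submodule.subset_span ⟨i, if_pos hi⟩)]
  by_contra hdeg
  refine htγ ⟨_, B', hB'F, rfl⟩ ?_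
  -- The form involves only entries on which `B'` and `D t` agree, so a degenerate `B'` would put
  -- the row of `D t` on an avoided hyperplane.
  rw [← hγ ⟨_, B', hB'F, rfl⟩ B' hB'F rfl hdeg, PiLp.inner_apply, PiLp.inner_apply]
  refine Finset.sum_congr rfl fun c _ => ?_
  by_cases hc : (c : ℕ) < n - 1 - j
  · have := hB'.2 ⟨j, by omega⟩ (Nat.lt_succ_self j) c (by simp only; omega)
    simp only [this]
    rfl
  · rw [heY _ c (not_lt.1 hc), inner_zero_right, inner_zero_right]

theorem exists_forall_completionsBelow_nondegenerate (hr : LinearIndependent ℝ fun i => A (r i))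
    {k : ℕ} (hk : k ≤ n - 1) {W : Set (Matrix (Fin m) (Fin n) ℝ)} (hW : IsOpen W)
    (hne : (solutionSet n (A * Aᵀ) ∩ W).Nonempty) :
    ∃ B ∈ solutionSet n (A * Aᵀ) ∩ W,
      ∀ j < k, ∀ B' ∈ completionsBelow (A * Aᵀ) r j B, NondegenerateBelow r j B' := by
  induction k with
  | zero =>
    obtain ⟨B, hB⟩ := hne
    exact ⟨B, hB, fun j hj => absurd hj (Nat.not_lt_zero _)⟩
  | succ k ih =>
    obtain ⟨B, hB, hBnd⟩ := ih (by omega)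
    rcases k with _ | l
    · refine ⟨B, hB, fun j hj B' _ => ?_⟩
      obtain rfl : j = 0 := by omega
      exact nondegenerateBelow_zero r B'
    -- Shrinking `W` to this open set preserves the earlier stages under the perturbation.
    · have hO : IsOpen (W ∩ ⋂ j ∈ Finset.range (l + 1), {B | B ∈ solutionSet n (A * Aᵀ) ∧
          ∃ B' ∈ completionsBelow (A * Aᵀ) r j B, ¬ NondegenerateBelow r j B'}ᶜ) :=
        hW.inter (isOpen_biInter_finset fun j _ =>
          (isClosed_exists_degenerate_completion hr j).isOpen_compl)
      obtain ⟨D, ⟨hD, hDO⟩, hDnd⟩ := exists_nondegenerate_perturbation (j := l) hr (by omega) hB.1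
        (fun i hi => hBnd i (by omega)) hO ⟨hB.2, Set.mem_iInter₂.2 fun j hj h => by
          obtain ⟨-, B', hB', hdeg⟩ := h
          exact hdeg (hBnd j (Finset.mem_range.1 hj) B' hB')⟩
      refine ⟨D, ⟨hD, hDO.1⟩, fun j hj B' hB' => ?_⟩
      rcases Nat.lt_succ_iff_lt_or_eq.1 hj with hj | rfl
      · by_contra hdeg
        exact Set.mem_iInter₂.1 hDO.2 j (Finset.mem_range.2 hj) ⟨hD, B', hB', hdeg⟩
      · exact hDnd B' hB'

theorem forGenericSolution_finite_completionsBelow (hr : LinearIndependent ℝ fun i => A (r i)) :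
    ForGenericSolution (A * Aᵀ) fun B => (completionsBelow (A * Aᵀ) r (n - 1) B).Finite := by
  refine forGenericSolution_of_forall_open fun W hW hne => ?_
  obtain ⟨B, hB, hnd⟩ := exists_forall_completionsBelow_nondegenerate hr le_rfl hW hne
  refine ⟨⋂ j ∈ Finset.range (n - 1), {B | B ∈ solutionSet n (A * Aᵀ) ∧
      ∃ B' ∈ completionsBelow (A * Aᵀ) r j B, ¬ NondegenerateBelow r j B'}ᶜ,
    isOpen_biInter_finset fun j _ => (isClosed_exists_degenerate_completion hr j).isOpen_compl,
    ⟨B, ⟨hB.1, Set.mem_iInter₂.2 fun j hj h => ?_⟩, hB.2⟩, ?_⟩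
  · obtain ⟨-, B', hB', hdeg⟩ := h
    exact hdeg (hnd j (Finset.mem_range.1 hj) B' hB')
  · rintro D ⟨hD, hDO⟩
    refine finite_completionsBelow hr fun j hj B' hB' => ?_
    by_contra hdeg
    exact Set.mem_iInter₂.1 hDO j (Finset.mem_range.2 hj) ⟨hD, B', hB', hdeg⟩

/-- The first `n - 1 - i` positions of each row `r i`. -/
def staircase (r : Fin (n - 1) → Fin m) : Finset (Fin m × Fin n) :=
  (Finset.univ.filter fun p : Fin (n - 1) × Fin n => (p.2 : ℕ) + 1 + p.1 < n).image
    fun p => (r p.1, p.2)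

theorem completions_staircase (C : Matrix (Fin m) (Fin m) ℝ) (r : Fin (n - 1) → Fin m)
    (B : Matrix (Fin m) (Fin n) ℝ) :
    completions C (staircase r) B = completionsBelow C r (n - 1) B := by
  ext B'
  refine and_congr_right fun _ => ⟨fun h i _ c hc => ?_, fun h p hp => ?_⟩
  · exact h (r i, c) (Finset.mem_image.2 ⟨(i, c), by simpa using hc, rfl⟩)
  · obtain ⟨⟨i, c⟩, hic, rfl⟩ := Finset.mem_image.1 hp
    exact h i i.2 c (by simpa using hic)

theorem card_staircase (hr : Function.Injective r) : (staircase r).card = n * (n - 1) / 2 := by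
  have hinj : Function.Injective fun p : Fin (n - 1) × Fin n => (r p.1, p.2) :=
    hr.prodMap Function.injective_id
  rw [staircase, Finset.card_image_of_injective _ hinj, ← Finset.univ_product_univ,
    Finset.card_filter, Finset.sum_product]
  simp only [← Finset.card_filter]
  have hcard : ∀ i : Fin (n - 1),
      (Finset.univ.filter fun c : Fin n => (c : ℕ) + 1 + i < n).card = n - 1 - i := by
    intro i
    refine Eq.trans ?_ (Fin.card_Iio (⟨n - 1 - i, by omega⟩ : Fin n))
    congr 1
    ext c
    simp only [Finset.mem_filter, Finset.mem_univ, true_and, Finset.mem_Iio, Fin.lt_def]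
    omega
  simp only [hcard]
  rw [Fin.sum_univ_eq_sum_range (fun i => n - 1 - i) (n - 1), ← Finset.sum_range_id,
    ← Finset.sum_range_reflect (fun i => i) n]
  -- The sum over `range n` has one extra term, at `n - 1`, and it vanishes.
  rcases n with _ | n
  · rfl
  · rw [Finset.sum_range_succ]
    simp

end Rows

/-! ### Comparison of the two bounds. -/

theorem ForGenericSolution.exists_and {m n : ℕ} {C : Matrix (Fin m) (Fin m) ℝ}
    {P Q : Matrix (Fin m) (Fin n) ℝ → Prop} (hP : ForGenericSolution C P)
    (hQ : ForGenericSolution C Q) (hne : (solutionSet n C).Nonempty) : ∃ B, P B ∧ Q B := by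
  obtain ⟨U, hU, hUd, hUP⟩ := hP
  obtain ⟨V, hV, hVd, hVQ⟩ := hQ
  obtain ⟨A, hA⟩ := hne
  obtain ⟨B, -, hB, hBU⟩ := mem_closure_iff.1 (hUd hA) Set.univ isOpen_univ trivial
  obtain ⟨D, hDU, hD, hDV⟩ := mem_closure_iff.1 (hVd hB) U hU hBU
  exact ⟨D, hUP D ⟨hD, hDU⟩, hVQ D ⟨hD, hDV⟩⟩

theorem theorem1 (m n : ℕ) (A : Matrix (Fin m) (Fin n) ℝ) (C : Matrix (Fin m) (Fin m) ℝ)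
    (hC : A * Aᵀ = C)
    (hA : ∃ r : Fin (n - 1) → Fin m, LinearIndependent ℝ fun i => A.row (r i)) :
    degreesOfFreedom n C = n * (n - 1) / 2 ∧
      ∀ S : Finset (Fin m × Fin n), S.card < n * (n - 1) / 2 →
        ForGenericSolution C fun B => (completions C S B).Infinite := by
  subst hC
  obtain ⟨r, hr⟩ := hA
  replace hr : LinearIndependent ℝ fun i => A (r i) := hr
  have hinf : ∀ S : Finset (Fin m × Fin n), S.card < n * (n - 1) / 2 →
      ForGenericSolution (A * Aᵀ) fun B => (completions (A * Aᵀ) S B).Infinite := fun S hS =>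
    forGenericSolution_infinite_completions hr (by omega) hS
  have hmem : n * (n - 1) / 2 ∈ {k : ℕ | ∃ S : Finset (Fin m × Fin n), S.card = k ∧
      ForGenericSolution (A * Aᵀ) fun B => (completions (A * Aᵀ) S B).Finite} := by
    refine ⟨staircase r, card_staircase fun i j h => hr.injective (by simp only [h]), ?_⟩
    simp only [completions_staircase]
    exact forGenericSolution_finite_completionsBelow hr
  refine ⟨le_antisymm (Nat.sInf_le hmem) (le_csInf ⟨_, hmem⟩ ?_), hinf⟩
  -- If `S` were too small, some common solution would have both finitely and infinitely many
  -- completions.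
  rintro _ ⟨S, rfl, hS⟩
  by_contra hlt
  obtain ⟨B, h1, h2⟩ := hS.exists_and (hinf S (not_le.1 hlt)) ⟨A, rfl⟩
  exact h2 h1
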